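/- Let $p\ge 3$ be a prime number and let $K$ be a field of characteristic $p$ that is complete with respect to a non-Archimedean absolute value $|\cdot|$. Call a power series over $K$ locally analytic if it converges on some disc of positive radius around $0$, and call a locally analytic power series $f(z)=\lambda z+\cdots\in K[\![z]\!]$ without constant term linearizable if there is a locally analytic power series $h(z)=b_0z+b_1z^2+\cdots\in K[\![z]\!]$, invertible under composition, such that $h\circ f\circ h^{-1}(z)=\lambda z$. Let $\lambda\in K$ be such that $\lambda$ is not a root of unity and $|1-\lambda|<1$, let $n\ge 1$ be an integer and let $a_n\in K$. Then the polynomial $\lambda z+a_nz^{n+1}\in K[z]$ is linearizable if and only if $p\mid n+1$ or $a_n=0$. -/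

import Mathlib

/-- A formal power series over a normed field is locally analytic at `0` if it converges at every
point of some disc of positive radius around `0`. -/
def IsLocallyAnalytic {K : Type*} [NormedField K] (f : PowerSeries K) : Prop :=
  ∃ r : ℝ, 0 < r ∧ ∀ z : K, ‖z‖ < r → Summable fun n : ℕ => PowerSeries.coeff n f * z ^ n

/-- A power series `f` without constant term is locally linearizable at `0` if there is a locally
analytic `h = b₀ z + b₁ z² + ⋯` with compositional inverse `g = h⁻¹` such that
`h ∘ f ∘ h⁻¹ = f'(0) z`. Here `PowerSeries.subst a F` is the composition `F ∘ a`. -/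
def IsLinearizable {K : Type*} [NormedField K] (f : PowerSeries K) : Prop :=
  ∃ h g : PowerSeries K,
    IsLocallyAnalytic h ∧
    PowerSeries.constantCoeff h = 0 ∧ PowerSeries.constantCoeff g = 0 ∧
    PowerSeries.subst g h = PowerSeries.X ∧ PowerSeries.subst h g = PowerSeries.X ∧
    PowerSeries.subst (PowerSeries.subst g f) h =
      PowerSeries.C (PowerSeries.coeff 1 f) * PowerSeries.X

/-
A formal linearization `h` is an invertible solution of `h ∘ f = λ h`; comparing coefficients shows
that it exists and that its coefficients are obtained by dividing by the small divisors `λ - λ ^ k`.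

Differentiating gives `(h' ∘ f) f' = λ h'`. If `f' = λ` is constant, that is `p ∣ n + 1` or
`a = 0`, then `h'` is invariant under `f`, hence constant because `λ` is not a root of unity. So
only coefficients of `h` in degrees `1` and `p, 2p, …` survive; there the small divisor has
the constant size `|1 - λ|`, and `h` converges.

Otherwise, in a degree `n i + 1` prime to `p`, the recursion for `h` has a unique term of largest
absolute value, so the coefficient of `h` has size `|b₁| |a| ^ i` divided by a product of small
divisors. As `|1 - λ ^ m| ≤ |1 - λ| ^ q` for every power `q` of `p` dividing `m`, for `i = p ^ k`
that product is at most `|1 - λ| ^ (k φ(p ^ k))`: the coefficients outgrow every geometric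
sequence.
-/

open PowerSeries

section FormalLinearization

section CommRing

variable {R : Type*} [CommRing R] {f : PowerSeries R}

lemma coeff_pow_eq_zero_of_lt (hf : constantCoeff f = 0) {k m : ℕ} (h : k < m) :
    coeff k (f ^ m) = 0 :=
  X_pow_dvd_iff.mp (pow_dvd_pow_of_dvd (X_dvd_iff.mpr hf) m) k h

lemma coeff_self_pow_of_constantCoeff_eq_zero (hf : constantCoeff f = 0) (k : ℕ) :
    coeff k (f ^ k) = coeff 1 f ^ k := by
  obtain ⟨g, rfl⟩ := X_dvd_iff.mpr hf
  rw [mul_pow, coeff_X_pow_mul', if_pos le_rfl, Nat.sub_self, coeff_zero_eq_constantCoeff_apply,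
    map_pow, ← coeff_zero_eq_constantCoeff_apply, ← coeff_succ_X_mul]

lemma coeff_subst_eq_add_sum_range (hf : constantCoeff f = 0) (h : PowerSeries R) (k : ℕ) :
    coeff k (subst f h) =
      coeff k h * coeff 1 f ^ k + ∑ m ∈ Finset.range k, coeff m h * coeff k (f ^ m) := by
  rw [coeff_subst' (HasSubst.of_constantCoeff_zero' hf),
    finsum_eq_finsetSum_of_support_subset (s := Finset.range (k + 1)), Finset.sum_range_succ,
    coeff_self_pow_of_constantCoeff_eq_zero hf, add_comm]
  · simp only [smul_eq_mul]
  · intro m hm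
    rw [Finset.coe_range, Set.mem_Iio]
    by_contra! hkm
    exact hm (by simp only [coeff_pow_eq_zero_of_lt hf hkm, smul_zero])

lemma subst_eq_C_mul_iff (hf : constantCoeff f = 0) (c : R) (h : PowerSeries R) :
    subst f h = C c * h ↔ ∀ k, coeff k h * (c - coeff 1 f ^ k) =
      ∑ m ∈ Finset.range k, coeff m h * coeff k (f ^ m) := by
  rw [PowerSeries.ext_iff]
  refine forall_congr' fun k => ?_
  rw [coeff_subst_eq_add_sum_range hf, coeff_C_mul]
  constructor <;> intro H <;> linear_combination -H

lemma eq_C_of_subst_eq_self [NoZeroDivisors R] (hf : constantCoeff f = 0)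
    (hroot : ∀ m : ℕ, 0 < m → coeff 1 f ^ m ≠ 1) {u : PowerSeries R} (hu : subst f u = u) :
    u = C (constantCoeff u) := by
  have hrec := (subst_eq_C_mul_iff hf 1 u).mp (by rw [hu, map_one, one_mul])
  have hzero (k : ℕ) (hk : 0 < k) : coeff k u = 0 := by
    induction k using Nat.strong_induction_on with
    | _ k ih =>
      refine (mul_eq_zero.mp ((hrec k).trans (Finset.sum_eq_zero fun m hm => ?_))).resolve_right
        (sub_ne_zero.mpr (hroot k hk).symm)
      rcases Nat.eq_zero_or_pos m with rfl | hm0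
      · rw [pow_zero, coeff_one, if_neg hk.ne', mul_zero]
      · rw [ih m (Finset.mem_range.mp hm) hm0, zero_mul]
  ext k
  rcases Nat.eq_zero_or_pos k with rfl | hk
  · simp
  · rw [hzero k hk, coeff_C, if_neg hk.ne']

lemma coeff_succ_eq_zero_of_coeff_derivative_eq_zero [NoZeroDivisors R] {p : ℕ} [CharP R p]
    {g : PowerSeries R} {k : ℕ} (hg : coeff k (d⁄dX R g) = 0) (hk : ¬ p ∣ k + 1) :
    coeff (k + 1) g = 0 := by
  rw [coeff_derivative] at hg
  exact (mul_eq_zero.mp hg).resolve_right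
    (by exact_mod_cast (CharP.cast_eq_zero_iff R p (k + 1)).not.mpr hk)

lemma coeff_succ_pow_eq_zero_of_dvd [NoZeroDivisors R] {p : ℕ} [CharP R p] (g : PowerSeries R)
    {m k : ℕ} (hm : p ∣ m) (hk : ¬ p ∣ k + 1) : coeff (k + 1) (g ^ m) = 0 := by
  refine coeff_succ_eq_zero_of_coeff_derivative_eq_zero ?_ hk
  rw [derivative_pow, ← map_natCast C, (CharP.cast_eq_zero_iff R p m).mpr hm]
  simp only [map_zero, zero_mul]

lemma sub_pow_ne_zero_of_pow_ne_one [NoZeroDivisors R] {l : R} (hl0 : l ≠ 0)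
    (hroot : ∀ m : ℕ, 0 < m → l ^ m ≠ 1) {k : ℕ} (hk : k ≠ 1) : l - l ^ k ≠ 0 := by
  rw [sub_ne_zero]
  obtain _ | k := k
  · simpa using hroot 1 one_pos
  · rw [pow_succ, ne_comm]
    exact fun h => hroot k (by omega) (mul_right_cancel₀ hl0 (h.trans (one_mul l).symm))

end CommRing

variable {K : Type*} [Field K] {f h : PowerSeries K}

/-- `h` is a formal linearization of `f`: an invertible solution, vanishing at `0`, of the Schröder
functional equation `h ∘ f = f'(0) h`. No convergence is required. -/
structure IsFormalLinearization (f h : PowerSeries K) : Prop where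
  constantCoeff_eq_zero : constantCoeff h = 0
  coeff_one_ne_zero : coeff 1 h ≠ 0
  subst_eq : subst f h = C (coeff 1 f) * h

lemma exists_triangular_solution (d y : ℕ → K) (A : ℕ → ℕ → K) (hd : ∀ k, d k ≠ 0) :
    ∃ b : ℕ → K, ∀ k, b k * d k = y k + ∑ m ∈ Finset.range k, b m * A m k := by
  let b : ℕ → K := fun k => Nat.strongRec
    (fun k ih => (y k + ∑ m : Fin k, ih m.1 m.2 * A m.1 k) / d k) k
  refine ⟨b, fun k => ?_⟩
  have hb : b k = (y k + ∑ m : Fin k, b m.1 * A m.1 k) / d k := by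
    simp only [b]
    rw [Nat.strongRec_eq]
  rw [hb, div_mul_cancel₀ _ (hd k), Finset.sum_range (fun m => b m * A m k)]

lemma exists_isFormalLinearization (hf : constantCoeff f = 0) (hf1 : coeff 1 f ≠ 0)
    (hroot : ∀ m : ℕ, 0 < m → coeff 1 f ^ m ≠ 1) :
    ∃ h : PowerSeries K, IsFormalLinearization f h := by
  -- the equation in degree `1` is vacuous and is replaced by the normalization `b 1 = 1`
  obtain ⟨b, hb⟩ := exists_triangular_solution
    (fun k => if k = 1 then 1 else coeff 1 f - coeff 1 f ^ k) (fun k => if k = 1 then 1 else 0)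
    (fun m k => if k = 1 then 0 else coeff k (f ^ m)) (by
      intro k
      split_ifs with hk
      · exact one_ne_zero
      · exact sub_pow_ne_zero_of_pow_ne_one hf1 hroot hk)
  have hb0 : b 0 = 0 := by
    simpa [sub_eq_zero, show coeff 1 f ≠ 1 by simpa using hroot 1 one_pos] using hb 0
  have hb1 : b 1 = 1 := by simpa using hb 1
  refine ⟨mk b, by simpa using hb0, by simp [hb1], ?_⟩
  rw [subst_eq_C_mul_iff hf]
  intro k
  rcases eq_or_ne k 1 with rfl | hk
  · simp [hb0]
  · simpa [hk] using hb k

lemma IsFormalLinearization.derivative_eq_C (hh : IsFormalLinearization f h)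
    (hf : constantCoeff f = 0) (hf1 : coeff 1 f ≠ 0)
    (hroot : ∀ m : ℕ, 0 < m → coeff 1 f ^ m ≠ 1) (hf' : d⁄dX K f = C (coeff 1 f)) :
    d⁄dX K h = C (constantCoeff (d⁄dX K h)) := by
  refine eq_C_of_subst_eq_self hf hroot ?_
  have hchain := congrArg (d⁄dX K) hh.subst_eq
  rw [derivative_subst (HasSubst.of_constantCoeff_zero' hf), hf', Derivation.leibniz,
    derivative_C, smul_zero, add_zero, smul_eq_mul, mul_comm] at hchain
  exact mul_left_cancel₀ ((map_ne_zero_iff C C_injective).mpr hf1) hchain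

lemma isLinearizable_iff_exists_isFormalLinearization {K : Type*} [NormedField K]
    {f : PowerSeries K} (hf : constantCoeff f = 0) :
    IsLinearizable f ↔ ∃ h, IsLocallyAnalytic h ∧ IsFormalLinearization f h := by
  have hfs := HasSubst.of_constantCoeff_zero' hf
  constructor
  · rintro ⟨h, g, hh, h0, g0, hhg, hgh, H⟩
    have hhs := HasSubst.of_constantCoeff_zero' h0
    have hgs := HasSubst.of_constantCoeff_zero' g0
    have hfgs := HasSubst.of_constantCoeff_zero' (constantCoeff_subst_eq_zero g0 f hf)
    refine ⟨h, hh, h0, fun h1 => ?_, ?_⟩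
    · have hcoeff := congrArg (coeff 1) hhg
      rw [coeff_subst_eq_add_sum_range g0, h1] at hcoeff
      simp at hcoeff
    · calc subst f h = subst (subst h (subst g f)) h := by
            rw [subst_comp_subst_apply hgs hhs, hgh, X_subst]
        _ = subst h (subst (subst g f) h) := (subst_comp_subst_apply hfgs hhs h).symm
        _ = C (coeff 1 f) * h := by
            rw [H, subst_mul hhs, subst_X hhs]
            congr 1
            exact subst_C _
  · rintro ⟨h, hh, h0, h1, H⟩
    have hu : IsUnit (coeff 1 h) := isUnit_iff_ne_zero.mpr h1
    have g0 := constantCoeff_substInvOfIsUnit h hu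
    have hgs := HasSubst.of_constantCoeff_zero' g0
    have hhg := subst_substInvOfIsUnit_right h h0 hu
    refine ⟨h, h.substInvOfIsUnit hu, hh, h0, g0, hhg, subst_substInvOfIsUnit_left h h0 hu, ?_⟩
    rw [← subst_comp_subst_apply hfs hgs, H, subst_mul hgs, hhg]
    congr 1
    exact subst_C _

end FormalLinearization

section LocallyAnalytic

variable {K : Type*} [NormedField K] {h : PowerSeries K}

lemma IsLocallyAnalytic.of_norm_coeff_le [CompleteSpace K] {C M : ℝ} (hM : 0 < M)
    (hb : ∀ k, ‖coeff k h‖ ≤ C * M ^ k) : IsLocallyAnalytic h := by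
  refine ⟨M⁻¹, inv_pos.mpr hM, fun z hz => ?_⟩
  have hMz : M * ‖z‖ < 1 := by rwa [← lt_inv_mul_iff₀ hM, mul_one]
  refine .of_norm_bounded ((summable_geometric_of_lt_one (by positivity) hMz).mul_left C)
    fun k => ?_
  rw [norm_mul, norm_pow, mul_pow, ← mul_assoc]
  gcongr
  exact hb k

lemma IsLocallyAnalytic.exists_norm_coeff_le (hh : IsLocallyAnalytic h) {t : K} (ht0 : t ≠ 0)
    (ht : ‖t‖ < 1) : ∃ C M : ℝ, 0 < M ∧ ∀ k, ‖coeff k h‖ ≤ C * M ^ k := by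
  obtain ⟨r, hr, hsum⟩ := hh
  obtain ⟨s, hs⟩ := exists_pow_lt_of_lt_one hr ht
  obtain ⟨C, hC⟩ := (hsum (t ^ s) (by rwa [norm_pow])).tendsto_atTop_zero.norm.bddAbove_range
  have hz : 0 < ‖t ^ s‖ := norm_pos_iff.mpr (pow_ne_zero s ht0)
  refine ⟨C, ‖t ^ s‖⁻¹, inv_pos.mpr hz, fun k => ?_⟩
  rw [inv_pow, ← div_eq_mul_inv, le_div_iff₀ (pow_pos hz k), ← norm_pow, ← norm_mul]
  exact hC ⟨k, rfl⟩

lemma isLocallyAnalytic_coe (q : Polynomial K) : IsLocallyAnalytic (q : PowerSeries K) := by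
  refine ⟨1, one_pos, fun z _ => summable_of_ne_finset_zero (s := q.support) fun k hk => ?_⟩
  rw [Polynomial.coeff_coe, Polynomial.notMem_support_iff.mp hk, zero_mul]

lemma exists_norm_coeff_succ_le {C M : ℝ} (hM : 0 < M) (hb : ∀ k, ‖coeff k h‖ ≤ C * M ^ k) {ρ : ℝ}
    (hρ : 0 < ρ) : ∃ M', 0 < M' ∧ ∀ k, 0 < k → ‖coeff (k + 1) h‖ ≤ ρ * M' ^ k := by
  set r := max 1 (C * M / ρ)
  have hr : 1 ≤ r := le_max_left _ _
  refine ⟨M * r, by positivity, fun k hk => ?_⟩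
  calc ‖coeff (k + 1) h‖ ≤ C * M * M ^ k := by
        rw [mul_assoc, ← pow_succ']
        exact hb (k + 1)
    _ ≤ r * ρ * M ^ k := by
        gcongr ?_ * M ^ k
        exact (div_le_iff₀ hρ).mp (le_max_right _ _)
    _ ≤ r ^ k * ρ * M ^ k := by
        gcongr
        exact le_self_pow₀ hr hk.ne'
    _ = ρ * (M * r) ^ k := by rw [mul_pow]; ring

end LocallyAnalytic

section SmallDivisors

variable {K : Type*} [NormedField K]

lemma norm_natCast_eq_one_of_not_dvd {p : ℕ} (hp : p.Prime) [CharP K p] {m : ℕ} (hm : ¬ p ∣ m) :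
    ‖(m : K)‖ = 1 := by
  have hpow : (m : K) ^ p.totient = 1 := by
    exact_mod_cast CharP.natCast_eq_natCast' K p
      (Nat.ModEq.pow_totient (hp.coprime_iff_not_dvd.mpr hm).symm)
  exact (isOfFinOrder_iff_pow_eq_one.mpr ⟨_, Nat.totient_pos.mpr hp.pos, hpow⟩).norm_eq_one

variable [IsUltrametricDist K] {l : K}

lemma norm_eq_one_of_norm_one_sub_lt_one (hl : ‖1 - l‖ < 1) : ‖l‖ = 1 := by
  have h := IsUltrametricDist.norm_eq_of_add_norm_lt_max (x := 1) (y := -l)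
    (by rw [← sub_eq_add_neg]; exact hl.trans_le (by simp))
  simpa using h.symm

lemma norm_one_sub_pow_le (hl : ‖1 - l‖ < 1) (m : ℕ) : ‖1 - l ^ m‖ ≤ ‖1 - l‖ := by
  induction m with
  | zero => simp
  | succ m ih =>
    rw [show 1 - l ^ (m + 1) = (1 - l) + l * (1 - l ^ m) by ring]
    refine (IsUltrametricDist.norm_add_le_max _ _).trans (max_le le_rfl ?_)
    rwa [norm_mul, norm_eq_one_of_norm_one_sub_lt_one hl, one_mul]

lemma norm_one_sub_pow_eq {p : ℕ} (hp : p.Prime) [CharP K p] (hl : ‖1 - l‖ < 1) {m : ℕ}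
    (hm : ¬ p ∣ m) : ‖1 - l ^ m‖ = ‖1 - l‖ := by
  -- the geometric sum `1 + l + ⋯ + l ^ (m - 1)` is congruent to `m` modulo `1 - l`
  have hsub : ‖(m : K) - ∑ i ∈ Finset.range m, l ^ i‖ < 1 := by
    rw [show (m : K) - ∑ i ∈ Finset.range m, l ^ i = ∑ i ∈ Finset.range m, (1 - l ^ i) by simp]
    exact (IsUltrametricDist.norm_sum_le_of_forall_le_of_nonneg (norm_nonneg (1 - l))
      fun i _ => norm_one_sub_pow_le hl i).trans_lt hl
  have hm1 : ‖(m : K)‖ = 1 := norm_natCast_eq_one_of_not_dvd hp hm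
  have hsum := IsUltrametricDist.norm_eq_of_add_norm_lt_max (x := (m : K))
    (y := -∑ i ∈ Finset.range m, l ^ i)
    (by rw [← sub_eq_add_neg]; exact hsub.trans_le (by rw [hm1]; exact le_max_left _ _))
  rw [hm1, norm_neg] at hsum
  rw [← mul_neg_geom_sum, norm_mul, ← hsum, mul_one]

lemma norm_one_sub_pow_le_pow_of_dvd {p : ℕ} (hp : p.Prime) [CharP K p] (hl : ‖1 - l‖ < 1)
    {m j : ℕ} (hm : p ^ j ∣ m) : ‖1 - l ^ m‖ ≤ ‖1 - l‖ ^ p ^ j := by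
  have : Fact p.Prime := ⟨hp⟩
  obtain ⟨k, rfl⟩ := hm
  have hfrob : 1 - (l ^ k) ^ p ^ j = (1 - l ^ k) ^ p ^ j := by rw [sub_pow_char_pow, one_pow]
  rw [mul_comm, pow_mul, hfrob, norm_pow]
  exact pow_le_pow_left₀ (norm_nonneg _) (norm_one_sub_pow_le hl k) _

end SmallDivisors

section Convergence

variable {K : Type*} [NormedField K] [IsUltrametricDist K] {f g h : PowerSeries K}
  {ρ M : ℝ}

lemma norm_coeff_mul_le (hρ1 : ρ ≤ 1) (hM : 0 ≤ M) (hf0 : ‖coeff 0 f‖ ≤ 1)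
    (hf : ∀ k, 0 < k → ‖coeff k f‖ ≤ ρ * M ^ k) (hg0 : ‖coeff 0 g‖ ≤ 1)
    (hg : ∀ k, 0 < k → ‖coeff k g‖ ≤ ρ * M ^ k) {k : ℕ} (hk : 0 < k) :
    ‖coeff k (f * g)‖ ≤ ρ * M ^ k := by
  rw [coeff_mul]
  have hρM : 0 ≤ ρ * M ^ k := (norm_nonneg _).trans (hf k hk)
  refine IsUltrametricDist.norm_sum_le_of_forall_le_of_nonneg hρM fun ij hij => ?_
  obtain ⟨i, j⟩ := ij
  obtain rfl : i + j = k := by simpa using hij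
  rw [norm_mul]
  rcases Nat.eq_zero_or_pos i with rfl | hi
  · rw [zero_add] at hk ⊢
    exact (mul_le_of_le_one_left (norm_nonneg _) hf0).trans (hg j hk)
  rcases Nat.eq_zero_or_pos j with rfl | hj
  · exact (mul_le_of_le_one_right (norm_nonneg _) hg0).trans (hf i hk)
  calc ‖coeff i f‖ * ‖coeff j g‖ ≤ M ^ i * (ρ * M ^ j) := by
        refine mul_le_mul ((hf i hi).trans ?_) (hg j hj) (norm_nonneg _) (by positivity)
        exact mul_le_of_le_one_left (by positivity) hρ1
    _ = ρ * M ^ (i + j) := by rw [pow_add]; ring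

lemma norm_coeff_pow_le (hρ0 : 0 ≤ ρ) (hρ1 : ρ ≤ 1) (hM : 0 ≤ M) (hg0 : ‖coeff 0 g‖ ≤ 1)
    (hg : ∀ k, 0 < k → ‖coeff k g‖ ≤ ρ * M ^ k) (m : ℕ) {k : ℕ} (hk : 0 < k) :
    ‖coeff k (g ^ m)‖ ≤ ρ * M ^ k := by
  induction m generalizing k with
  | zero =>
    rw [pow_zero, coeff_one, if_neg hk.ne', norm_zero]
    positivity
  | succ m ih =>
    rw [pow_succ]
    refine norm_coeff_mul_le hρ1 hM ?_ (fun _ => ih) hg0 hg hk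
    rw [coeff_zero_eq_constantCoeff_apply] at hg0 ⊢
    rw [map_pow, norm_pow]
    exact pow_le_one₀ (norm_nonneg _) hg0

lemma norm_coeff_pow_le_of_lt (hρ0 : 0 ≤ ρ) (hρ1 : ρ ≤ 1) (hM : 0 ≤ M)
    (hf0 : constantCoeff f = 0) (hf1 : ‖coeff 1 f‖ ≤ 1)
    (hf : ∀ k, 0 < k → ‖coeff (k + 1) f‖ ≤ ρ * M ^ k) {m k : ℕ} (hmk : m < k) :
    ‖coeff k (f ^ m)‖ ≤ ρ * M ^ (k - m) := by
  obtain ⟨g, rfl⟩ := X_dvd_iff.mpr hf0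
  simp only [coeff_succ_X_mul] at hf
  rw [← zero_add 1, coeff_succ_X_mul] at hf1
  rw [mul_pow, coeff_X_pow_mul', if_pos hmk.le]
  exact norm_coeff_pow_le hρ0 hρ1 hM hf1 hf m (Nat.sub_pos_of_lt hmk)

lemma IsFormalLinearization.norm_coeff_succ_le (hh : IsFormalLinearization f h)
    (hf0 : constantCoeff f = 0) (hρ0 : 0 < ρ) (hρ1 : ρ ≤ 1) (hM : 0 ≤ M)
    (hf1 : ‖coeff 1 f‖ ≤ 1) (hf : ∀ k, 0 < k → ‖coeff (k + 1) f‖ ≤ ρ * M ^ k)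
    (hdiv : ∀ k, 1 < k → coeff k h ≠ 0 → ρ ≤ ‖coeff 1 f - coeff 1 f ^ k‖) (k : ℕ) :
    ‖coeff (k + 1) h‖ ≤ ‖coeff 1 h‖ * M ^ k := by
  have hrec := (subst_eq_C_mul_iff hf0 _ _).mp hh.subst_eq
  induction k using Nat.strong_induction_on with
  | _ k ih =>
    rcases Nat.eq_zero_or_pos k with rfl | hk
    · simp
    by_cases hk0 : coeff (k + 1) h = 0
    · rw [hk0, norm_zero]
      positivity
    refine le_of_mul_le_mul_right ?_ hρ0
    calc ‖coeff (k + 1) h‖ * ρ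
        ≤ ‖coeff (k + 1) h * (coeff 1 f - coeff 1 f ^ (k + 1))‖ := by
          rw [norm_mul]
          exact mul_le_mul_of_nonneg_left (hdiv _ (by omega) hk0) (norm_nonneg _)
      _ ≤ ‖coeff 1 h‖ * M ^ k * ρ := by
          rw [hrec]
          refine IsUltrametricDist.norm_sum_le_of_forall_le_of_nonneg (by positivity) fun m hm => ?_
          rw [Finset.mem_range] at hm
          obtain _ | m := m
          · rw [coeff_zero_eq_constantCoeff_apply, hh.constantCoeff_eq_zero, zero_mul, norm_zero]
            positivity
          · calc _ ≤ ‖coeff 1 h‖ * M ^ m * (ρ * M ^ (k + 1 - (m + 1))) := by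
                  rw [norm_mul]
                  exact mul_le_mul (ih m (by omega))
                    (norm_coeff_pow_le_of_lt hρ0.le hρ1 hM hf0 hf1 hf hm) (norm_nonneg _)
                    (by positivity)
              _ = ‖coeff 1 h‖ * M ^ k * ρ := by
                  rw [Nat.add_sub_add_right, ← Nat.add_sub_of_le (show m ≤ k by omega), pow_add,
                    Nat.add_sub_cancel_left]
                  ring

lemma IsFormalLinearization.isLocallyAnalytic [CompleteSpace K] (hh : IsFormalLinearization f h)
    (hf : IsLocallyAnalytic f) (hf0 : constantCoeff f = 0) (hf1 : ‖coeff 1 f‖ ≤ 1) {t : K}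
    (ht0 : t ≠ 0) (ht : ‖t‖ < 1)
    (hdiv : ∀ k, 1 < k → coeff k h ≠ 0 → ‖t‖ ≤ ‖coeff 1 f - coeff 1 f ^ k‖) :
    IsLocallyAnalytic h := by
  obtain ⟨C, M, hM, hfM⟩ := hf.exists_norm_coeff_le ht0 ht
  obtain ⟨M', hM', hfM'⟩ := exists_norm_coeff_succ_le hM hfM (norm_pos_iff.mpr ht0)
  refine .of_norm_coeff_le (C := ‖coeff 1 h‖ * M'⁻¹) hM' fun k => ?_
  obtain _ | k := k
  · rw [coeff_zero_eq_constantCoeff_apply, hh.constantCoeff_eq_zero, norm_zero]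
    positivity
  · rw [pow_succ', mul_assoc, inv_mul_cancel_left₀ hM'.ne']
    exact hh.norm_coeff_succ_le hf0 (norm_pos_iff.mpr ht0) ht.le hM'.le hf1 hfM' hdiv k

theorem isLinearizable_of_derivative_eq_C [CompleteSpace K] {p : ℕ} (hp : p.Prime) [CharP K p]
    (hf : IsLocallyAnalytic f) (hf0 : constantCoeff f = 0)
    (hroot : ∀ m : ℕ, 0 < m → coeff 1 f ^ m ≠ 1) (hl : ‖1 - coeff 1 f‖ < 1)
    (hf' : d⁄dX K f = C (coeff 1 f)) : IsLinearizable f := by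
  have hl1 : ‖coeff 1 f‖ = 1 := norm_eq_one_of_norm_one_sub_lt_one hl
  have hl0 : coeff 1 f ≠ 0 := norm_ne_zero_iff.mp (hl1 ▸ one_ne_zero)
  have ht0 : 1 - coeff 1 f ≠ 0 := sub_ne_zero.mpr (by simpa using (hroot 1 one_pos).symm)
  obtain ⟨h, hh⟩ := exists_isFormalLinearization hf0 hl0 hroot
  have hh' := hh.derivative_eq_C hf0 hl0 hroot hf'
  refine (isLinearizable_iff_exists_isFormalLinearization hf0).mpr
    ⟨h, hh.isLocallyAnalytic hf hf0 hl1.le ht0 hl fun k hk hkh => ?_, hh⟩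
  obtain ⟨k, rfl⟩ := Nat.exists_eq_add_one_of_ne_zero (by omega : k ≠ 0)
  have hpk : p ∣ k + 1 := by
    by_contra hpk
    refine hkh (coeff_succ_eq_zero_of_coeff_derivative_eq_zero ?_ hpk)
    rw [hh', coeff_C, if_neg (by omega)]
  have hpk' : ¬ p ∣ k := fun hk => hp.not_dvd_one ((Nat.dvd_add_right hk).mp hpk)
  rw [pow_succ', ← mul_one_sub, norm_mul, hl1, one_mul, norm_one_sub_pow_eq hp hl hpk']

end Convergence

section LinearAddMonomial

variable {R : Type*} [CommRing R]

/-- The polynomial `l z + a z ^ (n + 1)`, as a power series. -/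
noncomputable def linearAddMonomial (l a : R) (n : ℕ) : PowerSeries R :=
  C l * X + C a * X ^ (n + 1)

lemma constantCoeff_linearAddMonomial (l a : R) (n : ℕ) :
    constantCoeff (linearAddMonomial l a n) = 0 := by
  simp [linearAddMonomial]

lemma coeff_one_linearAddMonomial (l a : R) {n : ℕ} (hn : 1 ≤ n) :
    coeff 1 (linearAddMonomial l a n) = l := by
  simp [linearAddMonomial, coeff_X_pow, show n ≠ 0 by omega]

lemma derivative_linearAddMonomial (l a : R) (n : ℕ) :
    d⁄dX R (linearAddMonomial l a n) = C l + C ((n + 1 : ℕ) * a) * X ^ n := by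
  simp only [linearAddMonomial, map_add, Derivation.leibniz, derivative_C, derivative_X,
    derivative_pow, smul_eq_mul, map_mul, map_natCast, Nat.add_sub_cancel]
  ring

lemma derivative_linearAddMonomial_eq_C_iff [IsDomain R] (p : ℕ) [CharP R p] (l a : R) {n : ℕ} :
    d⁄dX R (linearAddMonomial l a n) = C l ↔ p ∣ n + 1 ∨ a = 0 := by
  rw [derivative_linearAddMonomial, add_eq_left, mul_eq_zero_iff_right (pow_ne_zero n X_ne_zero),
    map_eq_zero_iff C C_injective, mul_eq_zero, CharP.cast_eq_zero_iff R p]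

lemma linearAddMonomial_pow (l a : R) (n m : ℕ) : linearAddMonomial l a n ^ m =
    ∑ j ∈ Finset.range (m + 1), C (a ^ j * l ^ (m - j) * m.choose j) * X ^ (m + n * j) := by
  rw [linearAddMonomial, add_comm, add_pow]
  refine Finset.sum_congr rfl fun j hj => ?_
  have hexp : m + n * j = (n + 1) * j + (m - j) := by
    have hjm : j ≤ m := Nat.lt_succ_iff.mp (Finset.mem_range.mp hj)
    rw [add_one_mul]
    omega
  rw [hexp, mul_pow, mul_pow, ← pow_mul, pow_add]
  simp only [map_mul, map_pow, map_natCast]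
  ring

lemma coeff_linearAddMonomial_pow (l a : R) {n : ℕ} (hn : 1 ≤ n) (m j : ℕ) :
    coeff (m + n * j) (linearAddMonomial l a n ^ m) = a ^ j * l ^ (m - j) * m.choose j := by
  have hinj (i : ℕ) : m + n * j = m + n * i ↔ j = i := by simp [show n ≠ 0 by omega]
  simp only [linearAddMonomial_pow, map_sum, coeff_C_mul, coeff_X_pow, hinj, mul_ite, mul_one,
    mul_zero, Finset.sum_ite_eq, Finset.mem_range, Nat.lt_succ_iff]
  split_ifs with hjm
  · rfl
  · rw [Nat.choose_eq_zero_of_lt (not_le.mp hjm), Nat.cast_zero, mul_zero]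

lemma exists_eq_add_mul_of_coeff_linearAddMonomial_pow_ne_zero {l a : R} {n m k : ℕ}
    (h : coeff k (linearAddMonomial l a n ^ m) ≠ 0) : ∃ j, k = m + n * j := by
  contrapose! h
  rw [linearAddMonomial_pow, map_sum]
  refine Finset.sum_eq_zero fun j _ => ?_
  rw [coeff_C_mul, coeff_X_pow, if_neg (h j), mul_zero]

lemma exists_index_of_coeff_linearAddMonomial_pow_ne_zero [NoZeroDivisors R] {p : ℕ} [CharP R p]
    {l a : R} {n : ℕ} (hn : 1 ≤ n) {i m : ℕ} (hi : ¬ p ∣ n * i + 1) (hm : m < n * i + 1)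
    (h : coeff (n * i + 1) (linearAddMonomial l a n ^ m) ≠ 0) :
    ∃ i' j, i = i' + j ∧ 0 < j ∧ m = n * i' + 1 ∧ ¬ p ∣ m := by
  have hpm : ¬ p ∣ m := fun hpm => h (coeff_succ_pow_eq_zero_of_dvd _ hpm hi)
  obtain ⟨j, hj⟩ := exists_eq_add_mul_of_coeff_linearAddMonomial_pow_ne_zero h
  have hm0 : m ≠ 0 := fun hm0 => hpm (hm0 ▸ dvd_zero p)
  have hji : j ≤ i := Nat.le_of_mul_le_mul_left (show n * j ≤ n * i by omega) hn
  obtain ⟨i', rfl⟩ := Nat.exists_eq_add_of_le' hji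
  refine ⟨i', j, rfl, Nat.pos_of_ne_zero ?_, ?_, hpm⟩
  · rintro rfl
    omega
  · rw [mul_add] at hj
    omega

end LinearAddMonomial

section GcdSum

lemma sum_gcd_range_eq_sum_divisors {n : ℕ} (hn : 0 < n) :
    ∑ x ∈ Finset.range n, n.gcd x = ∑ d ∈ n.divisors, d * (n / d).totient := by
  rw [← Finset.sum_fiberwise_of_maps_to
    (fun x _ => Nat.mem_divisors.mpr ⟨n.gcd_dvd_left x, hn.ne'⟩)]
  refine Finset.sum_congr rfl fun d hd => ?_
  rw [Finset.sum_congr rfl fun x hx => (Finset.mem_filter.mp hx).2, Finset.sum_const, smul_eq_mul,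
    Nat.totient_div_of_dvd (Nat.dvd_of_mem_divisors hd), mul_comm]

lemma sum_gcd_range_prime_pow {p : ℕ} (hp : p.Prime) (k : ℕ) :
    ∑ x ∈ Finset.range (p ^ k), (p ^ k).gcd x = p ^ k + k * (p ^ k).totient := by
  have hterm (j : ℕ) (hj : j ∈ Finset.range k) :
      p ^ j * (p ^ k / p ^ j).totient = (p ^ k).totient := by
    obtain ⟨i, rfl⟩ := Nat.exists_eq_add_of_lt (Finset.mem_range.mp hj)
    rw [Nat.pow_div (by omega) hp.pos, show j + i + 1 - j = i + 1 by omega,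
      Nat.totient_prime_pow_succ hp, Nat.totient_prime_pow_succ hp, pow_add, mul_assoc]
  rw [sum_gcd_range_eq_sum_divisors (pow_pos hp.pos k), Nat.sum_divisors_prime_pow hp,
    Finset.sum_range_succ, Finset.sum_congr rfl hterm, Finset.sum_const, Finset.card_range,
    smul_eq_mul, Nat.div_self (pow_pos hp.pos k), Nat.totient_one, mul_one, add_comm]

end GcdSum

section SmallDivisorProd

variable {K : Type*} [NormedField K]

/-- The contribution of the small divisor `l - l ^ (n * i + 1)` to the coefficient of degree
`n * i + 1` of the linearization of `l z + a z ^ (n + 1)`; it is `1` if `p ∣ n * i + 1`, because the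
dominant terms of the recursion skip such degrees. The norm is that of `1 - l ^ (n * i)`, as
`‖l‖ = 1` in the application. -/
noncomputable def smallDivisorFactor (p : ℕ) (l : K) (n i : ℕ) : ℝ :=
  if p ∣ n * i + 1 then 1 else ‖1 - l ^ (n * i)‖

/-- The product of the factors `smallDivisorFactor p l n x` over `1 ≤ x ≤ i`. -/
noncomputable def smallDivisorProd (p : ℕ) (l : K) (n i : ℕ) : ℝ :=
  ∏ x ∈ Finset.range i, smallDivisorFactor p l n (x + 1)

lemma smallDivisorProd_succ (p : ℕ) (l : K) (n i : ℕ) :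
    smallDivisorProd p l n (i + 1) =
      smallDivisorProd p l n i * smallDivisorFactor p l n (i + 1) :=
  Finset.prod_range_succ _ _

lemma smallDivisorProd_eq_mul_of_forall_dvd {p : ℕ} (l : K) {n i₀ i : ℕ} (hi₀ : i₀ < i)
    (hi : ¬ p ∣ n * i + 1) (hdvd : ∀ x, i₀ < x → x < i → p ∣ n * x + 1) :
    smallDivisorProd p l n i = smallDivisorProd p l n i₀ * ‖1 - l ^ (n * i)‖ := by
  obtain ⟨j, rfl⟩ := Nat.exists_eq_add_of_lt hi₀
  have hskip : ∏ x ∈ Finset.range j, smallDivisorFactor p l n (i₀ + x + 1) = 1 :=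
    Finset.prod_eq_one fun x hx =>
      if_pos (hdvd _ (by omega) (by have := Finset.mem_range.mp hx; omega))
  rw [smallDivisorProd_succ, smallDivisorProd, Finset.prod_range_add, hskip, mul_one,
    smallDivisorFactor, if_neg hi, smallDivisorProd]

variable {l : K}

lemma smallDivisorProd_pos (p : ℕ) (hroot : ∀ m : ℕ, 0 < m → l ^ m ≠ 1) {n : ℕ} (hn : 1 ≤ n)
    (i : ℕ) : 0 < smallDivisorProd p l n i := by
  refine Finset.prod_pos fun x _ => ?_
  rw [smallDivisorFactor]
  split_ifs
  · exact one_pos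
  · exact norm_pos_iff.mpr (sub_ne_zero.mpr (hroot _ (Nat.mul_pos hn x.succ_pos)).symm)

variable [IsUltrametricDist K]

lemma smallDivisorFactor_le_one (p : ℕ) (hl : ‖1 - l‖ < 1) (n i : ℕ) :
    smallDivisorFactor p l n i ≤ 1 := by
  rw [smallDivisorFactor]
  split_ifs
  · exact le_rfl
  · exact (norm_one_sub_pow_le hl _).trans hl.le

lemma smallDivisorProd_antitone (p : ℕ) (hroot : ∀ m : ℕ, 0 < m → l ^ m ≠ 1) (hl : ‖1 - l‖ < 1)
    {n : ℕ} (hn : 1 ≤ n) : Antitone (smallDivisorProd p l n) :=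
  antitone_nat_of_succ_le fun i => by
    rw [smallDivisorProd_succ]
    exact mul_le_of_le_one_right (smallDivisorProd_pos p hroot hn i).le
      (smallDivisorFactor_le_one p hl n _)

lemma smallDivisorProd_lt_of_not_dvd {p : ℕ} (hroot : ∀ m : ℕ, 0 < m → l ^ m ≠ 1)
    (hl : ‖1 - l‖ < 1) {n : ℕ} (hn : 1 ≤ n) {i j : ℕ} (hij : i < j) (hj : ¬ p ∣ n * j + 1) :
    smallDivisorProd p l n j < smallDivisorProd p l n i := by
  obtain ⟨j, rfl⟩ := Nat.exists_eq_add_one_of_ne_zero (by omega : j ≠ 0)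
  refine lt_of_lt_of_le ?_ (smallDivisorProd_antitone p hroot hl hn (Nat.lt_succ_iff.mp hij))
  rw [smallDivisorProd_succ, smallDivisorFactor, if_neg hj]
  exact mul_lt_of_lt_one_right (smallDivisorProd_pos p hroot hn j)
    ((norm_one_sub_pow_le hl _).trans_lt hl)

variable {p : ℕ} [CharP K p]

lemma smallDivisorFactor_mul_norm_le (hp : p.Prime) (hl : ‖1 - l‖ < 1) (n k i : ℕ) :
    smallDivisorFactor p l n i * ‖1 - l‖ ≤ ‖1 - l‖ ^ (p ^ k).gcd i := by
  obtain ⟨j, -, hj⟩ := (Nat.dvd_prime_pow hp).mp ((p ^ k).gcd_dvd_left i)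
  rw [hj]
  obtain _ | j := j
  · rw [pow_zero, pow_one]
    exact mul_le_of_le_one_left (norm_nonneg _) (smallDivisorFactor_le_one p hl n i)
  have hpji : p ^ (j + 1) ∣ n * i := (hj ▸ (p ^ k).gcd_dvd_right i).mul_left n
  have hpi : ¬ p ∣ n * i + 1 := fun h => hp.not_dvd_one
    ((Nat.dvd_add_right ((dvd_pow_self p j.succ_ne_zero).trans hpji)).mp h)
  rw [smallDivisorFactor, if_neg hpi]
  exact (mul_le_of_le_one_right (norm_nonneg _) hl.le).trans
    (norm_one_sub_pow_le_pow_of_dvd hp hl hpji)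

lemma smallDivisorProd_prime_pow_le (hp : p.Prime) (hl1 : l ≠ 1) (hl : ‖1 - l‖ < 1) (n k : ℕ) :
    smallDivisorProd p l n (p ^ k) ≤ ‖1 - l‖ ^ (k * (p ^ k).totient) := by
  have hρ : 0 < ‖1 - l‖ := norm_pos_iff.mpr (sub_ne_zero.mpr hl1.symm)
  have hnonneg (x : ℕ) : 0 ≤ smallDivisorFactor p l n x := by
    rw [smallDivisorFactor]
    split_ifs <;> positivity
  have hgcd : ∑ x ∈ Finset.range (p ^ k), (p ^ k).gcd (x + 1) =
      p ^ k + k * (p ^ k).totient := by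
    have hshift := (Finset.sum_range_succ' (p ^ k).gcd (p ^ k)).symm.trans
      (Finset.sum_range_succ (p ^ k).gcd (p ^ k))
    rwa [sum_gcd_range_prime_pow hp, Nat.gcd_zero_right, Nat.gcd_self, add_left_inj] at hshift
  refine le_of_mul_le_mul_right ?_ (pow_pos hρ (p ^ k))
  calc smallDivisorProd p l n (p ^ k) * ‖1 - l‖ ^ p ^ k
      = ∏ x ∈ Finset.range (p ^ k), smallDivisorFactor p l n (x + 1) * ‖1 - l‖ := by
        rw [Finset.prod_mul_distrib, Finset.prod_const, Finset.card_range, smallDivisorProd]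
    _ ≤ ∏ x ∈ Finset.range (p ^ k), ‖1 - l‖ ^ (p ^ k).gcd (x + 1) :=
        Finset.prod_le_prod (fun x _ => mul_nonneg (hnonneg _) hρ.le)
          fun x _ => smallDivisorFactor_mul_norm_le hp hl n k (x + 1)
    _ = ‖1 - l‖ ^ (k * (p ^ k).totient) * ‖1 - l‖ ^ p ^ k := by
        rw [Finset.prod_pow_eq_pow_sum, hgcd, ← pow_add, add_comm]

end SmallDivisorProd

section Divergence

lemma exists_dominant_index {p : ℕ} (hp : p.Prime) {n : ℕ} (hpn : ¬ p ∣ n + 1) {i : ℕ}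
    (hi : 0 < i) : ∃ i₀ j, i = i₀ + j ∧ 0 < j ∧ ¬ p ∣ n * i₀ + 1 ∧ ¬ p ∣ (n * i₀ + 1).choose j ∧
      ∀ x, i₀ < x → x < i → p ∣ n * x + 1 := by
  obtain ⟨e, rfl⟩ := Nat.exists_eq_add_one_of_ne_zero hi.ne'
  by_cases he : p ∣ n * e + 1
  swap
  · exact ⟨e, 1, rfl, one_pos, he, by rwa [Nat.choose_one_right], by omega⟩
  obtain _ | d := e
  · exact absurd (by simpa using he) hp.not_dvd_one
  have hd : ¬ p ∣ n * d + 1 := fun hd => by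
    rw [mul_add_one, add_right_comm, Nat.dvd_add_right hd] at he
    exact hp.not_dvd_one ((Nat.dvd_add_right (he.mul_right d)).mp hd)
  have hnd : ¬ p ∣ n * d := fun hnd => by
    rw [mul_add_one, add_assoc, Nat.dvd_add_right hnd] at he
    exact hpn he
  refine ⟨d, 2, rfl, two_pos, hd, fun hc => ?_, fun x hdx hxi => ?_⟩
  · have hchoose : (n * d + 1) * (n * d) = (n * d + 1).choose 2 * 2 := by
      simpa using Nat.add_one_mul_choose_eq (n * d) 1
    exact (hp.dvd_mul.mp (hchoose ▸ hc.mul_right 2)).elim hd hnd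
  · rwa [show x = d + 1 by omega]

variable {K : Type*} [NormedField K]

lemma norm_coeff_linearAddMonomial_pow {l : K} (hl : ‖l‖ = 1) (a : K) {n : ℕ} (hn : 1 ≤ n)
    (i j : ℕ) : ‖coeff (n * (i + j) + 1) (linearAddMonomial l a n ^ (n * i + 1))‖ =
      ‖a‖ ^ j * ‖((n * i + 1).choose j : K)‖ := by
  rw [mul_add, add_right_comm, coeff_linearAddMonomial_pow l a hn, norm_mul, norm_mul, norm_pow,
    norm_pow, hl, one_pow, mul_one]

variable [IsUltrametricDist K] {p : ℕ} [CharP K p] {l a : K} {n : ℕ} {h : PowerSeries K}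

lemma norm_sum_eq_of_dominant_index (hp : p.Prime) (hroot : ∀ m : ℕ, 0 < m → l ^ m ≠ 1)
    (hl : ‖1 - l‖ < 1) (hn : 1 ≤ n) (ha : a ≠ 0) (h1 : coeff 1 h ≠ 0) {i₀ j : ℕ} (hj : 0 < j)
    (hi : ¬ p ∣ n * (i₀ + j) + 1) (hi₀ : ¬ p ∣ n * i₀ + 1)
    (hchoose : ¬ p ∣ (n * i₀ + 1).choose j)
    (hskip : ∀ x, i₀ < x → x < i₀ + j → p ∣ n * x + 1)
    (ih : ∀ i < i₀ + j, ¬ p ∣ n * i + 1 → ‖coeff (n * i + 1) h‖ =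
      ‖coeff 1 h‖ * ‖a‖ ^ i / smallDivisorProd p l n i) :
    ‖∑ m ∈ Finset.range (n * (i₀ + j) + 1),
        coeff m h * coeff (n * (i₀ + j) + 1) (linearAddMonomial l a n ^ m)‖ =
      ‖coeff 1 h‖ * ‖a‖ ^ (i₀ + j) / smallDivisorProd p l n i₀ := by
  have hl1 := norm_eq_one_of_norm_one_sub_lt_one hl
  have hprod := smallDivisorProd_pos p hroot hn
  let t (m : ℕ) : K := coeff m h * coeff (n * (i₀ + j) + 1) (linearAddMonomial l a n ^ m)
  have hdom : ‖t (n * i₀ + 1)‖ = ‖coeff 1 h‖ * ‖a‖ ^ (i₀ + j) / smallDivisorProd p l n i₀ := by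
    rw [norm_mul, ih i₀ (by omega) hi₀, norm_coeff_linearAddMonomial_pow hl1 a hn,
      norm_natCast_eq_one_of_not_dvd hp hchoose, pow_add]
    ring
  have hmem : n * i₀ + 1 ∈ Finset.range (n * (i₀ + j) + 1) := by
    have := Nat.mul_pos hn hj
    rw [Finset.mem_range, mul_add]
    omega
  refine (IsUltrametricDist.isNonarchimedean_norm.apply_sum_eq_of_lt (fun x => (norm_neg x).symm)
    hmem fun m hm hne => ?_).trans hdom
  have hpos : 0 < ‖t (n * i₀ + 1)‖ := by
    have := hprod i₀
    rw [hdom]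
    positivity
  by_cases htm : coeff (n * (i₀ + j) + 1) (linearAddMonomial l a n ^ m) = 0
  · rwa [htm, mul_zero, norm_zero]
  obtain ⟨i', j', hij', hj', rfl, hi'⟩ :=
    exists_index_of_coeff_linearAddMonomial_pow_ne_zero hn hi (Finset.mem_range.mp hm) htm
  have hi'i₀ : i' < i₀ := by
    refine lt_of_le_of_ne ?_ (by rintro rfl; exact hne rfl)
    by_contra! hlt
    exact hi' (hskip i' hlt (by omega))
  calc ‖t (n * i' + 1)‖
      ≤ ‖coeff 1 h‖ * ‖a‖ ^ i' / smallDivisorProd p l n i' * ‖a‖ ^ j' := by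
        have := hprod i'
        rw [norm_mul, ih i' (by omega) hi', hij', norm_coeff_linearAddMonomial_pow hl1 a hn]
        gcongr
        exact mul_le_of_le_one_right (by positivity) (IsUltrametricDist.norm_natCast_le_one K _)
    _ = ‖coeff 1 h‖ * ‖a‖ ^ (i₀ + j) / smallDivisorProd p l n i' := by
        rw [hij', pow_add]
        ring
    _ < ‖t (n * i₀ + 1)‖ := by
        rw [hdom]
        exact div_lt_div_of_pos_left (by positivity) (hprod i₀)
          (smallDivisorProd_lt_of_not_dvd hroot hl hn hi'i₀ hi₀)

lemma IsFormalLinearization.norm_coeff_eq (hh : IsFormalLinearization (linearAddMonomial l a n) h)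
    (hp : p.Prime) (hroot : ∀ m : ℕ, 0 < m → l ^ m ≠ 1) (hl : ‖1 - l‖ < 1) (hn : 1 ≤ n)
    (hpn : ¬ p ∣ n + 1) (ha : a ≠ 0) {i : ℕ} (hi : ¬ p ∣ n * i + 1) :
    ‖coeff (n * i + 1) h‖ = ‖coeff 1 h‖ * ‖a‖ ^ i / smallDivisorProd p l n i := by
  have hrec := (subst_eq_C_mul_iff (constantCoeff_linearAddMonomial l a n) _ h).mp hh.subst_eq
  rw [coeff_one_linearAddMonomial l a hn] at hrec
  induction i using Nat.strong_induction_on with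
  | _ i ih =>
    rcases Nat.eq_zero_or_pos i with rfl | hi0
    · simp [smallDivisorProd]
    have hdiv : 0 < ‖1 - l ^ (n * i)‖ :=
      norm_pos_iff.mpr (sub_ne_zero.mpr (hroot _ (Nat.mul_pos hn hi0)).symm)
    have hcoeff := congrArg norm (hrec (n * i + 1))
    rw [pow_succ', ← mul_one_sub, norm_mul, norm_mul, norm_eq_one_of_norm_one_sub_lt_one hl,
      one_mul] at hcoeff
    obtain ⟨i₀, j, rfl, hj, hi₀, hchoose, hskip⟩ := exists_dominant_index hp hpn hi0
    rw [norm_sum_eq_of_dominant_index hp hroot hl hn ha hh.coeff_one_ne_zero hj hi hi₀ hchoose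
      hskip ih] at hcoeff
    rw [smallDivisorProd_eq_mul_of_forall_dvd l (by omega) hi hskip, ← div_div, ← hcoeff,
      mul_div_cancel_right₀ _ hdiv.ne']

lemma IsFormalLinearization.norm_coeff_one_le
    (hh : IsFormalLinearization (linearAddMonomial l a n) h) (hp : p.Prime)
    (hroot : ∀ m : ℕ, 0 < m → l ^ m ≠ 1) (hl : ‖1 - l‖ < 1) (hn : 1 ≤ n) (hpn : ¬ p ∣ n + 1)
    (ha : a ≠ 0) {C M : ℝ} (hM : 0 < M) (hC : ∀ k, ‖coeff k h‖ ≤ C * M ^ k) (N : ℕ) :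
    ‖coeff 1 h‖ ≤ C * M * ((M ^ n / ‖a‖) ^ p * ‖1 - l‖ ^ (N + 1)) ^ p ^ N := by
  have hl1 : l ≠ 1 := by simpa using hroot 1 one_pos
  have hC0 : 0 ≤ C := by simpa using (norm_nonneg _).trans (hC 0)
  have hgood : ¬ p ∣ n * p ^ (N + 1) + 1 := fun hd => hp.not_dvd_one
    ((Nat.dvd_add_right ((dvd_pow_self p N.succ_ne_zero).mul_left n)).mp hd)
  have hprod : smallDivisorProd p l n (p ^ (N + 1)) ≤ ‖1 - l‖ ^ ((N + 1) * p ^ N) := by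
    refine (smallDivisorProd_prime_pow_le hp hl1 hl n (N + 1)).trans
      (pow_le_pow_of_le_one (norm_nonneg _) hl.le (Nat.mul_le_mul_left _ ?_))
    rw [Nat.totient_prime_pow_succ hp]
    exact Nat.le_mul_of_pos_right _ (Nat.sub_pos_of_lt hp.one_lt)
  have hcoeff := hC (n * p ^ (N + 1) + 1)
  rw [hh.norm_coeff_eq hp hroot hl hn hpn ha hgood,
    div_le_iff₀ (smallDivisorProd_pos p hroot hn _)] at hcoeff
  calc ‖coeff 1 h‖
      ≤ C * M ^ (n * p ^ (N + 1) + 1) * ‖1 - l‖ ^ ((N + 1) * p ^ N) / ‖a‖ ^ p ^ (N + 1) := by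
        rw [le_div_iff₀ (by positivity)]
        exact hcoeff.trans (by gcongr)
    _ = C * M * ((M ^ n / ‖a‖) ^ p * ‖1 - l‖ ^ (N + 1)) ^ p ^ N := by
        rw [mul_pow, ← pow_mul, ← pow_mul, ← pow_succ', div_pow, ← pow_mul]
        ring

lemma IsFormalLinearization.not_isLocallyAnalytic
    (hh : IsFormalLinearization (linearAddMonomial l a n) h) (hp : p.Prime)
    (hroot : ∀ m : ℕ, 0 < m → l ^ m ≠ 1) (hl : ‖1 - l‖ < 1) (hn : 1 ≤ n) (hpn : ¬ p ∣ n + 1)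
    (ha : a ≠ 0) : ¬ IsLocallyAnalytic h := by
  intro hanalytic
  have hl1 : l ≠ 1 := by simpa using hroot 1 one_pos
  obtain ⟨C, M, hM, hC⟩ := hanalytic.exists_norm_coeff_le (sub_ne_zero.mpr hl1.symm) hl
  have hC0 : 0 ≤ C := by simpa using (norm_nonneg _).trans (hC 0)
  let u (N : ℕ) : ℝ := (M ^ n / ‖a‖) ^ p * ‖1 - l‖ ^ (N + 1)
  have hu : Filter.Tendsto u Filter.atTop (nhds 0) := by
    simpa using ((tendsto_pow_atTop_nhds_zero_of_lt_one (norm_nonneg _) hl).comp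
      (Filter.tendsto_add_atTop_nat 1)).const_mul ((M ^ n / ‖a‖) ^ p)
  have hle : ∀ᶠ N in Filter.atTop, ‖coeff 1 h‖ ≤ C * M * u N := by
    filter_upwards [hu.eventually_le_const one_pos] with N hN
    refine (hh.norm_coeff_one_le hp hroot hl hn hpn ha hM hC N).trans ?_
    gcongr
    exact pow_le_of_le_one (by positivity) hN (pow_pos hp.pos N).ne'
  have hlim := ge_of_tendsto (hu.const_mul (C * M)) hle
  rw [mul_zero, norm_le_zero_iff] at hlim
  exact hh.coeff_one_ne_zero hlim

end Divergence

theorem theorem1p4_general {K : Type*} [NormedField K] [CompleteSpace K] [IsUltrametricDist K]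
    (p : ℕ) (hp : p.Prime) [CharP K p]
    (l : K) (hroot : ∀ m : ℕ, 0 < m → l ^ m ≠ 1) (hl : ‖1 - l‖ < 1)
    (n : ℕ) (hn : 1 ≤ n) (a : K) :
    IsLinearizable
        ((Polynomial.C l * Polynomial.X + Polynomial.C a * Polynomial.X ^ (n + 1) :
          Polynomial K) : PowerSeries K) ↔
      p ∣ n + 1 ∨ a = 0 := by
  set q : Polynomial K := Polynomial.C l * Polynomial.X + Polynomial.C a * Polynomial.X ^ (n + 1)
  have hq : (q : PowerSeries K) = linearAddMonomial l a n := by simp [q, linearAddMonomial]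
  have hf0 := constantCoeff_linearAddMonomial l a n
  have hf1 := coeff_one_linearAddMonomial l a hn
  have hqa := isLocallyAnalytic_coe q
  rw [hq] at hqa ⊢
  constructor
  · intro hlin
    by_contra! ⟨hpn, ha⟩
    obtain ⟨h, hanalytic, hh⟩ := (isLinearizable_iff_exists_isFormalLinearization hf0).mp hlin
    exact hh.not_isLocallyAnalytic hp hroot hl hn hpn ha hanalytic
  · intro hpn
    refine isLinearizable_of_derivative_eq_C hp hqa hf0 (by rwa [hf1]) (by rwa [hf1]) ?_
    rw [hf1]
    exact (derivative_linearAddMonomial_eq_C_iff p l a).mpr hpn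

theorem theorem1p4 {K : Type*} [NormedField K] [CompleteSpace K] [IsUltrametricDist K]
    (p : ℕ) (hp : p.Prime) (hp3 : 3 ≤ p) [CharP K p]
    (l : K) (hroot : ∀ m : ℕ, 0 < m → l ^ m ≠ 1) (hl : ‖1 - l‖ < 1)
    (n : ℕ) (hn : 1 ≤ n) (a : K) :
    IsLinearizable
        ((Polynomial.C l * Polynomial.X + Polynomial.C a * Polynomial.X ^ (n + 1) :
          Polynomial K) : PowerSeries K) ↔
      p ∣ n + 1 ∨ a = 0 :=
  theorem1p4_general p hp l hroot hl n hn a
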